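/- Let $\delta>0$ and let $X$ be a proper geodesic metric space (closed balls are compact, any two points are joined by a geodesic) that is $\delta$-hyperbolic: for all $x,y,z,t\in X$, $\langle x,z\rangle_t\ge\min\{\langle x,y\rangle_t,\langle y,z\rangle_t\}-\delta$, where $\langle x,y\rangle_t=\frac12\left(|xt|+|yt|-|xy|\right)$. Let $G$ be a group acting on $X$ by isometries. Assume that the action is proper (for every $x\in X$ there is $r>0$ such that only finitely many $g\in G$ satisfy $gB(x,r)\cap B(x,r)\ne\emptyset$, where $B(x,r)$ is the closed ball) and co-compact ($X/G$ is compact). A subgroup of $G$ is called elementary if it is virtually cyclic (in particular finite subgroups are elementary). For $g\in G$ put $\|g\|=\inf_{x\in X}|gx\,x|$ and $A_g=\{x\in X : |gx\,x|\le\max\{\|g\|,8\delta\}\}$. For $Y\subset X$ and $\alpha\ge0$ let $Y^{+\alpha}=\{x\in X : d(x,Y)\le\alpha\}$. Let $\mathcal A$ be the set of pairs $(u,v)\in G^2$ generating a non-elementary subgroup and such that $\|u\|\le1000\delta$ and $\|v\|\le1000\delta$, and let $$A(G,X)=\sup_{(u,v)\in\mathcal A}\operatorname{diam}\left(A_u^{+17\delta}\cap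 A_v^{+17\delta}\right)\in[0,\infty]$$ (so $A(G,X)=0$ if $\mathcal A=\emptyset$). Assume that every elementary subgroup of $G$ is cyclic, and let $g,h\in G$ generate a non-elementary subgroup. Then: 1. if $\|g\|\le1000\delta$, then $\operatorname{diam}\left(A_g^{+17\delta}\cap A_h^{+17\delta}\right)\le\|h\|+A(G,X)+158\delta$; 2. without any assumption on $\|g\|$, $\operatorname{diam}\left(A_g^{+17\delta}\cap A_h^{+17\delta}\right)\le\|g\|+\|h\|+\max\{\|g\|,\|h\|\}+A(G,X)+676\delta$. -/

import Mathlib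

open scoped ENNReal

noncomputable section

namespace HypAction

/-- The Gromov product `(x|y)_z`. -/
def gromovProduct {X : Type*} [MetricSpace X] (x y z : X) : ℝ :=
  (dist x z + dist y z - dist x y) / 2

/-- Gromov's four point condition with constant `δ`. -/
def IsDeltaHyperbolic (X : Type*) [MetricSpace X] (δ : ℝ) : Prop :=
  ∀ x y z t : X,
    min (gromovProduct x y t) (gromovProduct y z t) - δ ≤ gromovProduct x z t

/-- Any two points are joined by a geodesic, i.e. an isometric embedding of `[0, dist x y]`. -/
def IsGeodesicSpace (X : Type*) [MetricSpace X] : Prop :=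
  ∀ x y : X, ∃ γ : ℝ → X, γ 0 = x ∧ γ (dist x y) = y ∧
    ∀ s ∈ Set.Icc 0 (dist x y), ∀ t ∈ Set.Icc 0 (dist x y), dist (γ s) (γ t) = |s - t|

/-- Every point has a closed ball of positive radius that meets only finitely many
of its translates. -/
def IsProperAction (G X : Type*) [Group G] [MetricSpace X] [MulAction G X] : Prop :=
  ∀ x : X, ∃ r : ℝ, 0 < r ∧
    {g : G | (((fun y : X => g • y) '' Metric.closedBall x r) ∩
      Metric.closedBall x r).Nonempty}.Finite

/-- The orbit space, with the quotient topology, is compact. -/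
def IsCocompactAction (G X : Type*) [Group G] [MetricSpace X] [MulAction G X] : Prop :=
  CompactSpace (Quotient (MulAction.orbitRel G X))

/-- A subgroup is elementary if it is virtually cyclic: it has a cyclic subgroup of
finite index (finite subgroups are therefore elementary). -/
def IsElementary {G : Type*} [Group G] (H : Subgroup G) : Prop :=
  ∃ K : Subgroup H, K.FiniteIndex ∧ IsCyclic K

/-- The translation length `‖g‖ = inf_x d(gx, x)`. -/
def translationLength {G : Type*} (X : Type*) [Group G] [MetricSpace X] [MulAction G X]
    (g : G) : ℝ :=
  ⨅ x : X, dist (g • x) x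

/-- The axis `A_g`: the points that `g` moves by at most `max {‖g‖, 8δ}`. -/
def axis {G : Type*} (X : Type*) [Group G] [MetricSpace X] [MulAction G X]
    (δ : ℝ) (g : G) : Set X :=
  {x : X | dist (g • x) x ≤ max (translationLength X g) (8 * δ)}

/-- The diameter, in `[0, ∞]`, of the intersection of the closed `17δ`-neighbourhoods of
the axes of `g` and `h`. -/
def axesOverlap {G : Type*} (X : Type*) [Group G] [MetricSpace X] [MulAction G X]
    (δ : ℝ) (g h : G) : ℝ≥0∞ :=
  Metric.ediam (Metric.cthickening (17 * δ) (axis X δ g) ∩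
    Metric.cthickening (17 * δ) (axis X δ h))

/-- The pairs of elements of translation length at most `1000δ` that generate a
non-elementary subgroup. -/
def shortPairs (G X : Type*) [Group G] [MetricSpace X] [MulAction G X] (δ : ℝ) :
    Set (G × G) :=
  {p : G × G | ¬ IsElementary (Subgroup.closure {p.1, p.2}) ∧
    translationLength X p.1 ≤ 1000 * δ ∧ translationLength X p.2 ≤ 1000 * δ}

/-- The invariant `A(G, X)`, a supremum in `[0, ∞]`; it depends on `δ`. -/
def overlapInvariant (G X : Type*) [Group G] [MetricSpace X] [MulAction G X] (δ : ℝ) :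
    ℝ≥0∞ :=
  ⨆ p ∈ shortPairs G X δ, axesOverlap X δ p.1 p.2

end HypAction

end

/-! Part 1 is immediate from the definition of `A(G, X)` when `h` is also short. A long `h` almost
translates along its axis (`IsDeltaHyperbolic.dist_smul_le_of_mem_axis`), so it slides a long
overlap of `A_g` and `A_h` along itself. Hence `A_g` and `h A_g`, the axis of `hgh⁻¹`, overlap in a
segment that is shorter by about `‖h‖` only (`ofReal_le_axesOverlap_conj`). As `hgh⁻¹` is as short
as `g`, `A(G, X)` bounds this overlap, provided that `g` and `hgh⁻¹` generate a non-elementary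
subgroup.

That proviso is `isElementary_closure_of_conj`, where cyclicity of elementary subgroups enters.
Suppose an element and one of its conjugates lie in a common cyclic group. If the element has finite
order, the conjugator normalizes the finite group it generates. If it has infinite order, comparing
stable translation lengths shows that the conjugator sends some power of it to itself or to its
inverse, hence preserves the axis of a loxodromic element, and such a stabilizer is virtually
cyclic.

For part 2 with `g` and `h` both long, replace them by inverses so that they slide the overlap in
the same direction. Then `gh` and `hg` almost agree on all but a final piece of length `‖g‖ + ‖h‖`,
so the commutator `u = g⁻¹h⁻¹gh` is short and its axis follows that of `h` along the rest. Part 1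
applied to `(u, h)` costs one more `‖h‖`. -/

namespace HypAction

/-! ### Segments in a hyperbolic geodesic space. -/

section Geometry

variable {X : Type*} [MetricSpace X] {δ : ℝ}

/-- The four point inequality, for distances. -/
theorem IsDeltaHyperbolic.four_point (hhyp : IsDeltaHyperbolic X δ) (x y z t : X) :
    dist x z + dist y t ≤
      max (dist x y + dist z t) (dist x t + dist y z) + 2 * δ := by
  have h := hhyp x y z t
  unfold gromovProduct at h
  rcases min_cases ((dist x t + dist y t - dist x y) / 2)
    ((dist y t + dist z t - dist y z) / 2) with ⟨h1, -⟩ | ⟨h1, -⟩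
  · rw [h1] at h
    have := le_max_left (dist x y + dist z t) (dist x t + dist y z)
    linarith
  · rw [h1] at h
    have := le_max_right (dist x y + dist z t) (dist x t + dist y z)
    linarith

theorem IsGeodesicSpace.exists_between (hgeod : IsGeodesicSpace X) (x y : X) {t : ℝ}
    (h0 : 0 ≤ t) (h1 : t ≤ dist x y) :
    ∃ m, dist x m = t ∧ dist m y = dist x y - t := by
  obtain ⟨γ, hx, hy, hγ⟩ := hgeod x y
  refine ⟨γ t, ?_, ?_⟩
  · have := hγ 0 ⟨le_rfl, dist_nonneg⟩ t ⟨h0, h1⟩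
    rw [hx] at this
    rw [this, zero_sub, abs_neg, abs_of_nonneg h0]
  · have := hγ t ⟨h0, h1⟩ (dist x y) ⟨dist_nonneg, le_rfl⟩
    rw [hy] at this
    rw [this, abs_sub_comm, abs_of_nonneg (by linarith)]

theorem IsDeltaHyperbolic.dist_le_of_between (hhyp : IsDeltaHyperbolic X δ) {x y m : X}
    (hm : dist x m + dist m y = dist x y) (z : X) :
    dist z m ≤ max (dist z x - dist x m) (dist z y - dist m y) + 2 * δ := by
  have h := hhyp.four_point z x m y
  have e : dist z x - dist x m + dist x y = dist z x + dist m y := by linarith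
  rcases le_total (dist z x + dist m y) (dist z y + dist x m) with h1 | h1
  · rw [max_eq_right h1] at h
    have := le_max_right (dist z x - dist x m) (dist z y - dist m y)
    linarith
  · rw [max_eq_left h1] at h
    have := le_max_left (dist z x - dist x m) (dist z y - dist m y)
    linarith

/-- A point of `[x, y]` which is far from the ends, compared with `x'` and `y'`, almost lies
on `[x', y']`. -/
theorem IsDeltaHyperbolic.dist_add_dist_le (hhyp : IsDeltaHyperbolic X δ) {x y m x' y' : X}
    (hm : dist x m + dist m y = dist x y)
    (hx : 4 * δ < dist x m + dist x' m - dist x x')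
    (hy : 4 * δ < dist y m + dist y' m - dist y y') :
    dist x' m + dist m y' ≤ dist x' y' + 4 * δ := by
  have h1 := hhyp x x' y m
  have h2 := hhyp x' y' y m
  unfold gromovProduct at h1 h2
  have c1 := dist_comm m y
  have c2 := dist_comm m y'
  have c3 := dist_comm y y'
  have hδ : 0 ≤ δ := by
    have := hhyp x x x x
    simpa [gromovProduct] using this
  -- Based at `m`, the product of `x` and `y` vanishes, while `hx` and `hy` make those of `x, x'`
  -- and of `y, y'` exceed `2δ`. So the product of `x'` and `y` is at most `δ`, and that of `x'` and
  -- `y'` at most `2δ`.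
  rcases min_le_iff.1 (sub_le_iff_le_add.1 h1) with h1 | h1
  · linarith
  rcases min_le_iff.1 (sub_le_iff_le_add.1 h2) with h2 | h2 <;> linarith

theorem IsDeltaHyperbolic.exists_between_dist_le (hhyp : IsDeltaHyperbolic X δ)
    (hgeod : IsGeodesicSpace X) {x y m : X} {c : ℝ}
    (h : dist x m + dist m y ≤ dist x y + 2 * c) :
    ∃ m', dist x m' + dist m' y = dist x y ∧ dist m m' ≤ c + 2 * δ := by
  have t1 := dist_triangle x m y
  have t2 := dist_triangle m x y
  have t3 := dist_triangle x y m
  have c1 := dist_comm m x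
  have c2 := dist_comm m y
  -- This `t` balances the two sides: `dist x m - dist x m'` and `dist m y - dist m' y` both equal
  -- half the excess of the path through `m`.
  obtain ⟨m', h1, h2⟩ := hgeod.exists_between x y
    (t := (dist x y + dist x m - dist m y) / 2) (by linarith) (by linarith)
  refine ⟨m', by linarith, (hhyp.dist_le_of_between (x := x) (y := y) (by linarith) m).trans ?_⟩
  gcongr
  exact max_le (by linarith) (by linarith)

end Geometry

/-! ### Geometry of the axes: displacement, quasi-convexity, translation. -/

section Axis

variable {G X : Type*} [Group G] [MetricSpace X] [MulAction G X] {δ : ℝ}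

theorem translationLength_le (g : G) (x : X) : translationLength X g ≤ dist (g • x) x :=
  ciInf_le ⟨0, by rintro _ ⟨y, rfl⟩; exact dist_nonneg⟩ x

theorem translationLength_nonneg (g : G) : 0 ≤ translationLength X g :=
  Real.iInf_nonneg fun _ => dist_nonneg

theorem dist_smul_le_translationLength {g : G} (hg : 8 * δ ≤ translationLength X g) {x : X}
    (hx : x ∈ axis X δ g) : dist (g • x) x ≤ translationLength X g := by
  simpa only [axis, Set.mem_ofPred_eq, max_eq_left hg] using hx

variable [IsIsometricSMul G X]

theorem dist_inv_smul_right (g : G) (x y : X) : dist x (g⁻¹ • y) = dist (g • x) y := by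
  rw [← dist_smul g x, smul_inv_smul]

theorem translationLength_inv (g : G) :
    translationLength X g⁻¹ = translationLength X g := by
  unfold translationLength
  congr 1
  funext x
  rw [dist_comm, dist_inv_smul_right]

theorem axis_inv (g : G) : axis X δ g⁻¹ = axis X δ g := by
  ext x
  simp only [axis, Set.mem_ofPred_eq, translationLength_inv]
  rw [dist_comm, dist_inv_smul_right]

theorem translationLength_conj (a g : G) :
    translationLength X (a * g * a⁻¹) = translationLength X g := by
  unfold translationLength
  refine (MulAction.toPerm a : X ≃ X).symm.iInf_congr fun x => ?_
  rw [show (MulAction.toPerm a : X ≃ X).symm x = a⁻¹ • x from rfl, ← dist_smul a]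
  simp [mul_smul]

theorem smul_mem_axis_conj {a g : G} {x : X} (hx : x ∈ axis X δ g) :
    a • x ∈ axis X δ (a * g * a⁻¹) := by
  simp only [axis, Set.mem_ofPred_eq, translationLength_conj] at hx ⊢
  rw [mul_smul, mul_smul, inv_smul_smul, dist_smul]
  exact hx

theorem smul_mem_axis {g : G} {x : X} (hx : x ∈ axis X δ g) : g • x ∈ axis X δ g := by
  simpa using smul_mem_axis_conj (a := g) hx

theorem isClosed_axis (g : G) : IsClosed (axis X δ g) :=
  isClosed_le ((continuous_const_smul g).dist continuous_id) continuous_const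

theorem mem_axis_of_between {g : G} {x m : X} (hx : x ∈ axis X δ g)
    (hm : dist x m + dist m (g • x) = dist x (g • x)) : m ∈ axis X δ g := by
  have h1 := dist_triangle m (g • x) (g • m)
  rw [dist_smul] at h1
  simp only [axis, Set.mem_ofPred_eq] at hx ⊢
  rw [dist_comm] at hx ⊢
  linarith

/-- Displacement of a point of `[x, y]`. -/
theorem IsDeltaHyperbolic.displacement_le (hhyp : IsDeltaHyperbolic X δ) (g : G) {x y m : X}
    (hm : dist x m + dist m y = dist x y) :
    dist (g • m) m ≤ max (max (dist (g • x) x - 2 * dist x m) (dist (g • y) y - 2 * dist m y))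
      (max (dist x (g • y)) (dist y (g • x)) - dist x y) + 4 * δ := by
  have hgm : dist (g • x) (g • m) + dist (g • m) (g • y) = dist (g • x) (g • y) := by
    simpa only [dist_smul] using hm
  have h1 := hhyp.dist_le_of_between hgm m
  have h2 := hhyp.dist_le_of_between hm (g • x)
  have h3 := hhyp.dist_le_of_between hm (g • y)
  simp only [dist_smul] at h1
  rw [dist_comm (g • m) m]
  rw [dist_comm (g • x) m] at h2
  rw [dist_comm (g • y) m] at h3
  rw [dist_comm (g • x) y] at h2
  rw [dist_comm (g • y) x] at h3
  rw [← sub_le_iff_le_add] at h1 h2 h3 ⊢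
  simp only [le_max_iff] at h1 h2 h3 ⊢
  have k1 := le_max_left (dist x (g • y)) (dist y (g • x))
  have k2 := le_max_right (dist x (g • y)) (dist y (g • x))
  rcases h1 with h1 | h1
  · rcases h2 with h2 | h2
    · left; left; linarith
    · right; linarith
  · rcases h3 with h3 | h3
    · right; linarith
    · left; right; linarith

/-- The displacement of a point is governed by its distance to the axis. -/
theorem exists_mem_axis_dist_le [ProperSpace X] (hδ : 0 < δ) (hgeod : IsGeodesicSpace X)
    (hhyp : IsDeltaHyperbolic X δ) {g : G} (hne : (axis X δ g).Nonempty) (x : X) :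
    ∃ a ∈ axis X δ g, 2 * dist x a + max (translationLength X g) (8 * δ) - 10 * δ ≤
      dist (g • x) x := by
  obtain ⟨p, hp, hpd⟩ := (isClosed_axis g).exists_infDist_eq_dist hne x
  have hmin : ∀ q ∈ axis X δ g, dist x p ≤ dist x q := fun q hq =>
    hpd ▸ Metric.infDist_le_dist_of_mem hq
  by_cases hx : x ∈ axis X δ g
  · refine ⟨x, hx, ?_⟩
    have h1 := translationLength_le g x
    have h2 := dist_nonneg (x := g • x) (y := x)
    rw [dist_self]
    rcases max_cases (translationLength X g) (8 * δ) with ⟨h, -⟩ | ⟨h, -⟩ <;> rw [h] <;> linarith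
  refine ⟨p, hp, ?_⟩
  set l := max (translationLength X g) (8 * δ) with hl
  have hl8 : 8 * δ ≤ l := le_max_right _ _
  -- the projection is displaced by exactly `l`
  have hpl : dist (g • p) p = l := by
    refine le_antisymm hp (not_lt.1 fun hlt => ?_)
    have hpos : 0 < dist x p := dist_pos.2 fun h => hx (h ▸ hp)
    obtain ⟨q, hq1, hq2⟩ := hgeod.exists_between p x
      (t := min (dist p x) ((l - dist (g • p) p) / 2)) (le_min dist_nonneg (by linarith))
      (min_le_left _ _)
    have hq : q ∈ axis X δ g := by
      have t1 := dist_triangle (g • q) (g • p) q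
      have t2 := dist_triangle (g • p) p q
      rw [dist_smul, dist_comm q p] at t1
      have := min_le_right (dist p x) ((l - dist (g • p) p) / 2)
      show dist (g • q) q ≤ l
      linarith
    have h1 := hmin q hq
    have h2 : 0 < min (dist p x) ((l - dist (g • p) p) / 2) :=
      lt_min (by rwa [dist_comm]) (by linarith)
    rw [dist_comm x q, hq2, dist_comm x p] at h1
    linarith
  -- moving along `[p, g p]` increases the distance to the projected point
  have key : ∀ z p q : X, l ≤ dist p q →
      (∀ r, dist p r + dist r q = dist p q → dist z p ≤ dist z r) →
      dist z p + dist p q - 4 * δ ≤ dist z q := by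
    intro z p q hpq hr
    refine le_of_forall_pos_le_add fun ε hε => ?_
    -- Going just over `2δ` from `p` makes one alternative of `dist_le_of_between` contradict the
    -- minimality of `dist z p`; the other gives the bound up to `ε`. Capping by `δ` keeps `r` on
    -- the segment, as `3δ < l`.
    obtain ⟨r, hr1, hr2⟩ := hgeod.exists_between p q (t := 2 * δ + min ε δ)
      (by positivity) (by linarith [min_le_right ε δ])
    have h1 := hr r (by linarith)
    have h2 := hhyp.dist_le_of_between (x := p) (y := q) (m := r) (by linarith) z
    rw [← sub_le_iff_le_add, le_max_iff] at h2
    have h3 : 0 < min ε δ := lt_min hε hδ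
    have h4 := min_le_left ε δ
    rcases h2 with h2 | h2 <;> linarith
  have k1 := key x p (g • p) (by rw [dist_comm, hpl]) fun r hr =>
    hmin r (mem_axis_of_between hp hr)
  have k2 := key (g • x) (g • p) p hpl.ge fun r hr => by
    have hr' : r ∈ axis X δ g := mem_axis_of_between hp (by
      rw [add_comm, dist_comm p r, dist_comm p, dist_comm r (g • p)]; exact hr)
    have hr2 : g⁻¹ • r ∈ axis X δ g := by
      simpa only [axis_inv] using smul_mem_axis (g := g⁻¹) (x := r) (δ := δ) (by rwa [axis_inv])
    have := hmin _ hr2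
    rw [dist_inv_smul_right] at this
    simpa using this
  -- One alternative would force `2 * l ≤ 10 * δ`, against `8 * δ ≤ l`; the other is the claim.
  have h4 := hhyp.four_point x p (g • p) (g • x)
  simp only [dist_smul] at h4 k2
  rw [dist_comm p (g • p)] at h4 k1
  rw [dist_comm p x, dist_comm p (g • x), dist_comm x (g • x)] at h4
  have h5 := dist_comm p x
  rw [← sub_le_iff_le_add, le_max_iff] at h4
  rcases h4 with h4 | h4 <;> linarith

/-- The axis is quasi-convex. -/
theorem exists_mem_axis_of_between [ProperSpace X] (hδ : 0 < δ) (hgeod : IsGeodesicSpace X)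
    (hhyp : IsDeltaHyperbolic X δ) {g : G} {x y m : X} (hx : x ∈ axis X δ g)
    (hy : y ∈ axis X δ g) (hm : dist x m + dist m y = dist x y) :
    ∃ a ∈ axis X δ g, dist m a ≤ 7 * δ := by
  obtain ⟨a, ha, h⟩ := exists_mem_axis_dist_le hδ hgeod hhyp ⟨x, hx⟩ m
  refine ⟨a, ha, ?_⟩
  have h1 := hhyp.displacement_le g hm
  have h2 : max (max (dist (g • x) x - 2 * dist x m) (dist (g • y) y - 2 * dist m y))
      (max (dist x (g • y)) (dist y (g • x)) - dist x y) ≤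
        max (translationLength X g) (8 * δ) := by
    have a1 : dist (g • x) x ≤ max (translationLength X g) (8 * δ) := hx
    have a2 : dist (g • y) y ≤ max (translationLength X g) (8 * δ) := hy
    have t1 := dist_triangle x y (g • y)
    have t2 := dist_triangle y x (g • x)
    rw [dist_comm y (g • y)] at t1
    rw [dist_comm x (g • x), dist_comm y x] at t2
    have n1 := dist_nonneg (x := x) (y := m)
    have n2 := dist_nonneg (x := m) (y := y)
    refine max_le (max_le (by linarith) (by linarith)) ?_
    rw [sub_le_iff_le_add]
    exact max_le (by linarith) (by linarith)
  linarith

/-- The middle part of a segment with ends near the axis is near the axis. -/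
theorem exists_mem_axis_of_between_of_near [ProperSpace X] (hδ : 0 < δ)
    (hgeod : IsGeodesicSpace X) (hhyp : IsDeltaHyperbolic X δ) {g : G} {x y m a b : X}
    (ha : a ∈ axis X δ g) (hb : b ∈ axis X δ g)
    (hm : dist x m + dist m y = dist x y)
    (hxa : 4 * δ < dist x m + dist a m - dist x a)
    (hyb : 4 * δ < dist y m + dist b m - dist y b) :
    ∃ c ∈ axis X δ g, dist m c ≤ 11 * δ := by
  have h1 := hhyp.dist_add_dist_le hm hxa hyb
  obtain ⟨m', h2, h3⟩ := hhyp.exists_between_dist_le hgeod (c := 2 * δ)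
    (h1.trans (by linarith))
  obtain ⟨c, hc, h4⟩ := exists_mem_axis_of_between hδ hgeod hhyp ha hb h2
  exact ⟨c, hc, (dist_triangle m m' c).trans (by linarith)⟩

/-- A loxodromic element translates along its axis. -/
theorem IsDeltaHyperbolic.dist_smul_le_of_mem_axis (hhyp : IsDeltaHyperbolic X δ)
    (hgeod : IsGeodesicSpace X) {g : G} (hδ : 0 < δ) (hg : 8 * δ ≤ translationLength X g)
    {x y : X} (hx : x ∈ axis X δ g) (hy : y ∈ axis X δ g)
    (hL : translationLength X g ≤ dist x y) :
    dist x (g • y) ≤ dist x y - translationLength X g + 6 * δ ∨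
      dist y (g • x) ≤ dist x y - translationLength X g + 6 * δ := by
  have hx' := dist_smul_le_translationLength hg hx
  have hy' := dist_smul_le_translationLength hg hy
  -- The midpoint is displaced by at least `‖g‖`, so one of the crossed distances `dist x (g • y)`,
  -- `dist y (g • x)` is large; their sum is at most `2 * dist x y + 2 * δ`, so the other is small.
  obtain ⟨m, h1, h2⟩ := hgeod.exists_between x y (t := dist x y / 2)
    (by positivity) (by linarith [dist_nonneg (x := x) (y := y)])
  have h3 := hhyp.displacement_le g (x := x) (y := y) (m := m) (by linarith)
  have h4 := translationLength_le g m
  have h5 := hhyp.four_point x y (g • y) (g • x)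
  rw [dist_comm (g • y) (g • x), dist_smul, dist_comm x (g • x), dist_comm y (g • y),
    ← sub_le_iff_le_add, le_max_iff] at h5
  rw [← sub_le_iff_le_add, le_max_iff, le_max_iff] at h3
  have h6 : dist x (g • y) + dist y (g • x) ≤ 2 * dist x y + 2 * δ := by
    rcases h5 with h5 | h5 <;> linarith
  have h7 : dist x y + translationLength X g - 4 * δ ≤
      max (dist x (g • y)) (dist y (g • x)) := by
    rcases h3 with (h3 | h3) | h3 <;> linarith
  rcases le_max_iff.1 h7 with h7 | h7
  · right; linarith
  · left; linarith

/-- The midpoint of `[x, g x]` is displaced by at least `‖g‖`, which `displacement_le` allows only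
if `g² x` is far from `x`. -/
theorem two_mul_translationLength_le [Nonempty X] (hhyp : IsDeltaHyperbolic X δ)
    (hgeod : IsGeodesicSpace X) {g : G} (hg : 4 * δ < translationLength X g) :
    2 * translationLength X g - 4 * δ ≤ translationLength X (g ^ 2) := by
  refine le_ciInf fun x => ?_
  obtain ⟨m, h1, h2⟩ := hgeod.exists_between x (g • x) (t := dist x (g • x) / 2)
    (by positivity) (by linarith [dist_nonneg (x := x) (y := g • x)])
  have h3 := hhyp.displacement_le g (x := x) (y := g • x) (m := m) (by linarith)
  have h4 := translationLength_le g m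
  have h5 := translationLength_le g x
  rw [smul_smul, ← sq, dist_self, dist_comm x (g ^ 2 • x)] at h3
  have h6 : dist (g ^ 2 • x) (g • x) = dist (g • x) x := by
    rw [sq, mul_smul, dist_smul]
  have h7 := dist_comm x (g • x)
  rw [← sub_le_iff_le_add, le_max_iff, le_max_iff] at h3
  rw [max_eq_left dist_nonneg] at h3
  rcases h3 with (h3 | h3) | h3 <;> linarith

end Axis

/-! ### Consequences of properness and cocompactness; stable translation length. -/

section Action

open Filter Topology

variable {G X : Type*} [Group G] [MetricSpace X] [MulAction G X] {δ : ℝ}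

theorem IsProperAction.finite_setOf_dist_le [ProperSpace X] (hproper : IsProperAction G X)
    (x : X) (R : ℝ) : {g : G | dist (g • x) x ≤ R}.Finite := by
  choose r hr hfin using hproper
  obtain ⟨t, -, ht⟩ := (isCompact_closedBall x R).elim_nhds_subcover
    (fun y => Metric.closedBall y (r y)) fun y _ => Metric.closedBall_mem_nhds y (hr y)
  have hsub : {g : G | dist (g • x) x ≤ R} ⊆
      ⋃ y ∈ t, {g : G | g • x ∈ Metric.closedBall y (r y)} := fun g hg => by
    simpa using ht (Metric.mem_closedBall.2 hg)
  refine (t.finite_toSet.biUnion fun y _ => ?_).subset hsub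
  rcases Set.eq_empty_or_nonempty {g : G | g • x ∈ Metric.closedBall y (r y)} with h | ⟨a, ha⟩
  · rw [h]; exact Set.finite_empty
  · refine ((hfin y).preimage (f := fun g => g * a⁻¹)
      (mul_left_injective a⁻¹).injOn).subset fun g hg => ?_
    exact ⟨g • x, ⟨a • x, ha, by simp [mul_smul]⟩, hg⟩

variable [IsIsometricSMul G X]

theorem dist_smul_self_le (g : G) (x y : X) :
    dist (g • x) x ≤ dist (g • y) y + 2 * dist x y := by
  have h1 := dist_triangle4 (g • x) (g • y) y x
  rw [dist_smul, dist_comm y x] at h1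
  linarith

theorem IsCocompactAction.exists_dist_le (hcocompact : IsCocompactAction G X) (x₀ : X) :
    ∃ R : ℝ, ∀ x : X, ∃ g : G, dist (g • x) x₀ ≤ R := by
  have : CompactSpace (Quotient (MulAction.orbitRel G X)) := hcocompact
  let π : X → Quotient (MulAction.orbitRel G X) := Quotient.mk _
  have hmono : Monotone fun n : ℕ => π '' Metric.ball x₀ n := fun m n h =>
    Set.image_mono (Metric.ball_subset_ball (by exact_mod_cast h))
  obtain ⟨n, hn⟩ := isCompact_univ.elim_directed_cover (fun n : ℕ => π '' Metric.ball x₀ n)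
    (fun n => isOpenMap_quotient_mk'_mul _ Metric.isOpen_ball)
    (fun q _ => by
      obtain ⟨x, rfl⟩ := Quotient.exists_rep q
      obtain ⟨n, hn⟩ := exists_nat_gt (dist x x₀)
      exact Set.mem_iUnion.2 ⟨n, x, hn, rfl⟩)
    hmono.directed_le
  refine ⟨n, fun x => ?_⟩
  obtain ⟨y, hy, hxy⟩ := hn (Set.mem_univ (π x))
  obtain ⟨g, rfl⟩ := (MulAction.orbitRel_apply.1 (Quotient.exact hxy))
  exact ⟨g, (Metric.mem_ball.1 hy).le⟩

/-- In a proper cocompact action the displacement of an element attains its infimum. -/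
theorem exists_dist_eq_translationLength [ProperSpace X] [Nonempty X]
    (hproper : IsProperAction G X) (hcocompact : IsCocompactAction G X) (g : G) :
    ∃ x : X, dist (g • x) x = translationLength X g := by
  obtain ⟨x₀⟩ := ‹Nonempty X›
  obtain ⟨R, hR⟩ := hcocompact.exists_dist_le x₀
  have hR0 : 0 ≤ R := by obtain ⟨a, ha⟩ := hR x₀; exact dist_nonneg.trans ha
  have hmin : ∀ b : G, ∃ y ∈ Metric.closedBall x₀ R, ∀ z ∈ Metric.closedBall x₀ R,
      dist (b • y) y ≤ dist (b • z) z := fun b =>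
    (isCompact_closedBall x₀ R).exists_isMinOn ⟨x₀, Metric.mem_closedBall_self hR0⟩
      ((continuous_const_smul b).dist continuous_id).continuousOn
  choose y hy hymin using hmin
  -- Cocompactness moves an almost minimal point into a fixed ball at the price of conjugating `g`;
  -- by properness only the finitely many conjugates in `F` can occur, and each attains its minimum
  -- on the ball.
  let F : Set G := {b | (∃ a, b = a * g * a⁻¹) ∧
    dist (b • x₀) x₀ ≤ translationLength X g + 1 + 2 * R}
  have hF : F.Finite := (hproper.finite_setOf_dist_le x₀ _).subset fun b hb => hb.2
  have hmove : ∀ x : X, dist (g • x) x < translationLength X g + 1 → ∃ b ∈ F,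
      dist (b • y b) (y b) ≤ dist (g • x) x := fun x hx => by
    obtain ⟨a, ha⟩ := hR x
    have e : dist ((a * g * a⁻¹) • a • x) (a • x) = dist (g • x) x := by simp [mul_smul]
    refine ⟨a * g * a⁻¹, ⟨⟨a, rfl⟩, ?_⟩, e ▸ hymin _ _ ha⟩
    have := dist_smul_self_le (a * g * a⁻¹) x₀ (a • x)
    rw [dist_comm x₀] at this
    linarith
  obtain ⟨x, hx⟩ := exists_lt_of_ciInf_lt (lt_add_one (translationLength X g))
  obtain ⟨b₁, hb₁, -⟩ := hmove x hx
  obtain ⟨b, hb, hbmin⟩ := F.exists_min_image (fun b => dist (b • y b) (y b)) hF ⟨b₁, hb₁⟩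
  obtain ⟨a, rfl⟩ := hb.1
  set μ := dist ((a * g * a⁻¹) • y (a * g * a⁻¹)) (y (a * g * a⁻¹)) with hμ
  refine ⟨a⁻¹ • y (a * g * a⁻¹), le_antisymm ?_ (translationLength_le g _)⟩
  have e : dist (g • a⁻¹ • y (a * g * a⁻¹)) (a⁻¹ • y (a * g * a⁻¹)) = μ := by
    rw [dist_inv_smul_right, hμ]; simp [mul_smul]
  rw [e]
  refine le_of_not_gt fun hlt => ?_
  obtain ⟨x, hx⟩ := exists_lt_of_ciInf_lt
    (lt_min hlt (lt_add_one (translationLength X g)))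
  obtain ⟨b, hbF, hb⟩ := hmove x (lt_min_iff.1 hx).2
  exact absurd (lt_min_iff.1 hx).1 (not_lt.2 ((hbmin b hbF).trans hb))

theorem axis_nonempty [ProperSpace X] [Nonempty X]
    (hproper : IsProperAction G X) (hcocompact : IsCocompactAction G X) (δ : ℝ) (g : G) :
    (axis X δ g).Nonempty :=
  let ⟨x, hx⟩ := exists_dist_eq_translationLength hproper hcocompact g
  ⟨x, hx.le.trans (le_max_left _ _)⟩

/-- An element of infinite order is loxodromic: some power has large translation length. -/
theorem exists_lt_translationLength_pow [ProperSpace X] [Nonempty X] (hδ : 0 < δ)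
    (hgeod : IsGeodesicSpace X) (hhyp : IsDeltaHyperbolic X δ)
    (hproper : IsProperAction G X) (hcocompact : IsCocompactAction G X) {z : G}
    (hz : ¬ IsOfFinOrder z) (B : ℝ) : ∃ k : ℕ, B < translationLength X (z ^ k) := by
  by_contra! hB
  have hinj := injective_pow_iff_not_isOfFinOrder.2 hz
  obtain ⟨x₀⟩ := ‹Nonempty X›
  have : Nonempty X := ⟨x₀⟩
  obtain ⟨R, hR⟩ := hcocompact.exists_dist_le x₀
  have hS := hproper.finite_setOf_dist_le (G := G) x₀ (max B (8 * δ) + 22 * δ + 2 * R)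
  set n := hS.toFinset.card with hn
  set D := ∑ i ∈ Finset.range (n + 1), dist (z ^ i • x₀) x₀ with hD
  have hDi : ∀ i ∈ Finset.range (n + 1), dist (z ^ i • x₀) x₀ ≤ D := fun i hi =>
    Finset.single_le_sum (f := fun i => dist (z ^ i • x₀) x₀) (fun _ _ => dist_nonneg) hi
  -- For `i ≤ n`, `z ^ i` moves both `x₀` and `z ^ N • x₀` by at most `D`, so both lie within `D / 2
  -- + δ` of its axis. The margin `6 * δ` puts the midpoint far enough from the ends to be
  -- `11δ`-close to that axis.
  obtain ⟨N, hN⟩ : ∃ N : ℕ, D + 6 * δ < dist (z ^ N • x₀) x₀ := by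
    by_contra! h
    exact Set.infinite_of_injective_forall_mem hinj h
      (hproper.finite_setOf_dist_le x₀ (D + 6 * δ))
  rw [dist_comm] at hN
  obtain ⟨m, hm1, hm2⟩ := hgeod.exists_between x₀ (z ^ N • x₀)
    (t := dist x₀ (z ^ N • x₀) / 2) (by positivity)
    (by linarith [dist_nonneg (x := x₀) (y := z ^ N • x₀)])
  obtain ⟨b, hb⟩ := hR m
  -- The bound does not depend on `n`: conjugating by `b` thus gives `n + 1` distinct elements in a
  -- set of cardinality `n`.
  have hmove : ∀ i ∈ Finset.range (n + 1), dist (z ^ i • m) m ≤ max B (8 * δ) + 22 * δ := by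
    intro i hi
    have hne := axis_nonempty hproper hcocompact δ (z ^ i)
    obtain ⟨p, hp, hp'⟩ := exists_mem_axis_dist_le hδ hgeod hhyp hne x₀
    obtain ⟨q, hq, hq'⟩ := exists_mem_axis_dist_le hδ hgeod hhyp hne (z ^ N • x₀)
    have e : dist (z ^ i • z ^ N • x₀) (z ^ N • x₀) = dist (z ^ i • x₀) x₀ := by
      rw [smul_smul, ← pow_add, add_comm, pow_add, mul_smul, dist_smul]
    have h1 := hDi i hi
    have h8 := le_max_right (translationLength X (z ^ i)) (8 * δ)
    have t1 := dist_triangle x₀ p m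
    have t2 := dist_triangle (z ^ N • x₀) q m
    have t3 := dist_triangle x₀ m p
    have t4 := dist_triangle (z ^ N • x₀) m q
    have c1 := dist_comm m p
    have c2 := dist_comm m q
    have c3 := dist_comm m (z ^ N • x₀)
    obtain ⟨c, hc, hc'⟩ := exists_mem_axis_of_between_of_near hδ hgeod hhyp hp hq
      (m := m) (x := x₀) (y := z ^ N • x₀) (by linarith) (by linarith) (by linarith)
    have h2 := dist_smul_self_le (z ^ i) m c
    have h3 : dist (z ^ i • c) c ≤ max B (8 * δ) :=
      le_trans hc (max_le_max_right _ (hB i))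
    linarith
  have hcard := Finset.card_le_card_of_injOn (s := Finset.range (n + 1)) (t := hS.toFinset)
    (fun i => b * z ^ i * b⁻¹) (fun i hi => by
      simp only [Set.Finite.coe_toFinset, Set.mem_ofPred_eq]
      have h1 := dist_smul_self_le (b * z ^ i * b⁻¹) x₀ (b • m)
      have h2 := hmove i hi
      have e : dist ((b * z ^ i * b⁻¹) • b • m) (b • m) = dist (z ^ i • m) m := by
        simp [mul_smul]
      rw [e, dist_comm x₀] at h1
      linarith)
    (fun i _ j _ hij => hinj (by simpa using hij))
  rw [Finset.card_range] at hcard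
  omega

theorem le_translationLength_pow_two_pow [Nonempty X] (hgeod : IsGeodesicSpace X)
    (hhyp : IsDeltaHyperbolic X δ) {g : G} (hg : 4 * δ < translationLength X g) (j : ℕ) :
    2 ^ j * (translationLength X g - 4 * δ) ≤ translationLength X (g ^ 2 ^ j) - 4 * δ := by
  induction j with
  | zero => simp
  | succ j ih =>
    have hpos : 0 < 2 ^ j * (translationLength X g - 4 * δ) :=
      mul_pos (by positivity) (by linarith)
    have h := two_mul_translationLength_le hhyp hgeod (g := g ^ 2 ^ j) (by linarith)
    rw [← pow_mul, ← pow_succ] at h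
    rw [pow_succ]
    linarith

/-- Elements of infinite order have a positive stable translation length. -/
theorem exists_stableLength [ProperSpace X] (hδ : 0 < δ)
    (hgeod : IsGeodesicSpace X) (hhyp : IsDeltaHyperbolic X δ)
    (hproper : IsProperAction G X) (hcocompact : IsCocompactAction G X) {h : G}
    (hh : ¬ IsOfFinOrder h) (x : X) :
    ∃ τ : ℝ, 0 < τ ∧ ∀ a : ℕ, a ≠ 0 →
      Tendsto (fun n : ℕ => dist (h ^ (a * n) • x) x / n) atTop (𝓝 (a * τ)) := by
  have : Nonempty X := ⟨x⟩
  set u : ℕ → ℝ := fun n => dist (h ^ n • x) x with hu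
  have hsub : Subadditive u := fun m n => by
    have := dist_triangle (h ^ (m + n) • x) (h ^ m • x) x
    rw [pow_add, mul_smul, dist_smul] at this
    simp only [hu, pow_add, mul_smul]
    linarith
  have hbdd : BddBelow (Set.range fun n : ℕ => u n / n) :=
    ⟨0, by rintro _ ⟨n, rfl⟩; exact div_nonneg dist_nonneg n.cast_nonneg⟩
  have hlim := hsub.tendsto_lim hbdd
  have hmul : ∀ a : ℕ, a ≠ 0 → Tendsto (fun n : ℕ => a * n) atTop atTop := fun a ha =>
    tendsto_id.const_mul_atTop' (Nat.pos_of_ne_zero ha)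
  refine ⟨hsub.lim, ?_, fun a ha => ?_⟩
  -- Along the subsequence `k * 2 ^ j` the displacement is at least `2 ^ j * δ`, so the limit is at
  -- least `δ / k`.
  · obtain ⟨k, hk⟩ := exists_lt_translationLength_pow hδ hgeod hhyp hproper hcocompact hh (5 * δ)
    have hk0 : k ≠ 0 := by
      rintro rfl
      have := translationLength_le (1 : G) x
      rw [one_smul, dist_self] at this
      rw [pow_zero] at hk
      linarith
    have h1 : Tendsto (fun j : ℕ => k * 2 ^ j) atTop atTop :=
      (hmul k hk0).comp (tendsto_pow_atTop_atTop_of_one_lt one_lt_two)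
    have hkpos : (0 : ℝ) < k := by exact_mod_cast Nat.pos_of_ne_zero hk0
    refine lt_of_lt_of_le (div_pos hδ hkpos)
      (ge_of_tendsto' (hlim.comp h1) fun j => ?_)
    have h2 := le_translationLength_pow_two_pow hgeod hhyp (g := h ^ k) (by linarith) j
    have h3 := translationLength_le ((h ^ k) ^ 2 ^ j) x
    rw [← pow_mul] at h2 h3
    simp only [Function.comp_apply, hu]
    push_cast
    have h4 : 2 ^ j * δ ≤ 2 ^ j * (translationLength X (h ^ k) - 4 * δ) := by
      gcongr; linarith
    rw [div_le_div_iff₀ hkpos (by positivity)]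
    nlinarith
  · have h1 := (hlim.comp (hmul a ha)).const_mul (a : ℝ)
    refine h1.congr fun n => ?_
    have : (a : ℝ) ≠ 0 := by exact_mod_cast ha
    simp only [Function.comp_apply, hu]
    push_cast
    field_simp

/-- Conjugation by `g` changes displacements of `x` by a bounded amount, which disappears in the
stable length: `|q| τ ≤ |p| τ`. -/
theorem natAbs_le_of_conj_zpow [ProperSpace X] [Nonempty X] (hδ : 0 < δ)
    (hgeod : IsGeodesicSpace X) (hhyp : IsDeltaHyperbolic X δ)
    (hproper : IsProperAction G X) (hcocompact : IsCocompactAction G X) {g h : G}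
    (hh : ¬ IsOfFinOrder h) {p q : ℤ} (hp : p ≠ 0) (hq : q ≠ 0)
    (hpq : g * h ^ p * g⁻¹ = h ^ q) : q.natAbs ≤ p.natAbs := by
  obtain ⟨x⟩ := ‹Nonempty X›
  obtain ⟨τ, hτ, hlim⟩ := exists_stableLength hδ hgeod hhyp hproper hcocompact hh x
  have habs : ∀ (k : ℤ) (n : ℕ), dist (h ^ (k.natAbs * n) • x) x = dist (h ^ (k * n) • x) x := by
    intro k n
    rcases Int.natAbs_eq k with hk | hk
    · conv_rhs => rw [hk]
      norm_cast
    · conv_rhs => rw [hk]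
      rw [neg_mul, zpow_neg, dist_comm (_⁻¹ • x), dist_inv_smul_right]
      norm_cast
  have hle : ∀ n : ℕ, dist (h ^ (q.natAbs * n) • x) x / n ≤
      dist (h ^ (p.natAbs * n) • x) x / n + 2 * dist x (g • x) / n := by
    intro n
    rw [← add_div, habs, habs]
    gcongr
    have e : h ^ (q * n) = g * h ^ (p * n) * g⁻¹ := by
      rw [zpow_mul, zpow_mul, ← hpq, conj_zpow]
    have h1 := dist_smul_self_le (g * h ^ (p * n) * g⁻¹) x (g • x)
    have h2 : dist ((g * h ^ (p * n) * g⁻¹) • g • x) (g • x) = dist (h ^ (p * n) • x) x := by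
      simp [mul_smul]
    rw [e]
    linarith
  have h1 := le_of_tendsto_of_tendsto' (hlim _ (Int.natAbs_ne_zero.2 hq))
    ((hlim _ (Int.natAbs_ne_zero.2 hp)).add
      (tendsto_const_div_atTop_nhds_zero_nat (2 * dist x (g • x)))) hle
  rw [add_zero] at h1
  exact_mod_cast le_of_mul_le_mul_right h1 hτ

/-- A subgroup which contains a loxodromic element and preserves its axis is elementary. -/
theorem isElementary_of_le_stabilizer_axis [ProperSpace X] [Nonempty X] (hδ : 0 < δ)
    (hgeod : IsGeodesicSpace X) (hhyp : IsDeltaHyperbolic X δ)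
    (hproper : IsProperAction G X) (hcocompact : IsCocompactAction G X) {w : G}
    (hw : 8 * δ ≤ translationLength X w) {H : Subgroup G} (hwH : w ∈ H)
    (hH : ∀ a ∈ H, ∀ x ∈ axis X δ w, a • x ∈ axis X δ w) : IsElementary H := by
  obtain ⟨x₀, hx₀⟩ := axis_nonempty hproper hcocompact δ w
  -- Applying `w` or `w⁻¹` brings a point of the axis closer to `x₀` by at least `‖w‖ - 6δ ≥ 2δ`,
  -- hence the induction in steps of `2δ`.
  have hcov : ∀ n : ℕ, ∀ y ∈ axis X δ w, dist y x₀ ≤ translationLength X w + n * (2 * δ) →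
      ∃ k : ℤ, dist (w ^ k • y) x₀ ≤ translationLength X w := by
    intro n
    induction n with
    | zero => intro y _ h; exact ⟨0, by simpa using h⟩
    | succ n ih =>
      intro y hy h
      rcases le_total (dist y x₀) (translationLength X w) with h1 | h1
      · exact ⟨0, by simpa using h1⟩
      push_cast at h
      rcases hhyp.dist_smul_le_of_mem_axis hgeod hδ hw hy hx₀ h1 with h2 | h2
      · obtain ⟨k, hk⟩ := ih (w⁻¹ • y)
          (by simpa only [axis_inv] using
            smul_mem_axis (g := w⁻¹) (x := y) (δ := δ) (by rwa [axis_inv]))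
          (by rw [dist_comm, dist_inv_smul_right, dist_comm]; linarith)
        refine ⟨k - 1, ?_⟩
        rwa [zpow_sub_one, mul_smul]
      · obtain ⟨k, hk⟩ := ih (w • y) (smul_mem_axis hy) (by rw [dist_comm]; linarith)
        refine ⟨k + 1, ?_⟩
        rwa [zpow_add_one, mul_smul]
  have hcov' : ∀ y ∈ axis X δ w, ∃ k : ℤ, dist (w ^ k • y) x₀ ≤ translationLength X w := by
    intro y hy
    obtain ⟨n, hn⟩ := exists_nat_ge (dist y x₀ / (2 * δ))
    refine hcov n y hy ?_
    rw [div_le_iff₀ (by positivity)] at hn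
    linarith [translationLength_nonneg (X := X) w]
  refine ⟨Subgroup.zpowers ⟨w, hwH⟩, ?_, inferInstance⟩
  have hfin : Finite {b : H | dist ((b : G) • x₀) x₀ ≤ translationLength X w} :=
    ((hproper.finite_setOf_dist_le x₀ _).preimage Subtype.val_injective.injOn).to_subtype
  -- Every coset of `⟨w⟩` has a representative moving `x₀` by at most `‖w‖`, and there are finitely
  -- many such elements.
  have : Finite (H ⧸ Subgroup.zpowers (⟨w, hwH⟩ : H)) := by
    refine Finite.of_surjective (α := {b : H | dist ((b : G) • x₀) x₀ ≤ translationLength X w})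
      (fun b => (b.1 : H ⧸ Subgroup.zpowers (⟨w, hwH⟩ : H))) fun q => ?_
    obtain ⟨a, rfl⟩ := QuotientGroup.mk_surjective q
    obtain ⟨k, hk⟩ := hcov' _ (hH (a⁻¹ : H) (a⁻¹).2 x₀ hx₀)
    refine ⟨⟨a * ⟨w, hwH⟩ ^ (-k), ?_⟩, ?_⟩
    · rw [smul_smul, ← dist_inv_smul_right, dist_comm] at hk
      simpa using hk
    · rw [QuotientGroup.eq]
      simp
  exact Subgroup.finiteIndex_of_finite_quotient

end Action

/-! ### Group theory for elements of finite order. -/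

section Elementary

variable {G : Type*} [Group G]

theorem isOfFinOrder_of_zpow {x : G} {i : ℤ} (hi : i ≠ 0) (h : IsOfFinOrder (x ^ i)) :
    IsOfFinOrder x := by
  rcases Int.natAbs_eq i with hk | hk <;> rw [hk] at h
  · rw [zpow_natCast] at h
    exact (isOfFinOrder_pow.1 h).resolve_right (Int.natAbs_ne_zero.2 hi)
  · rw [zpow_neg, zpow_natCast, isOfFinOrder_inv_iff] at h
    exact (isOfFinOrder_pow.1 h).resolve_right (Int.natAbs_ne_zero.2 hi)

open scoped Pointwise in
-- As `⟨h⟩` is finite, `g` normalizes it, so the generated group is `⟨h⟩⟨g⟩`, where `⟨g⟩` has finite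
-- index.
theorem isElementary_of_isOfFinOrder_of_conj_mem {g h : G} (hh : IsOfFinOrder h)
    (hconj : g * h * g⁻¹ ∈ Subgroup.zpowers h) : IsElementary (Subgroup.closure {g, h}) := by
  have hfin : Finite (Subgroup.zpowers h) := hh.finite_zpowers
  have hg : g ∈ Subgroup.normalizer (Subgroup.zpowers h : Set G) := by
    have : Finite ((Subgroup.zpowers h : Subgroup G) : Set G) := hfin
    refine Subgroup.mem_normalizer_fintype fun n hn => ?_
    obtain ⟨k, rfl⟩ := hn
    rw [← conj_zpow]
    exact Subgroup.zpow_mem _ hconj k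
  have hmul := Subgroup.coe_mul_of_right_le_normalizer_left (Subgroup.zpowers h)
    (Subgroup.zpowers g) (Subgroup.zpowers_le.2 hg)
  have hgH : g ∈ Subgroup.closure {g, h} := Subgroup.subset_closure (by simp)
  have hhH : h ∈ Subgroup.closure {g, h} := Subgroup.subset_closure (by simp)
  have hle : Subgroup.closure {g, h} ≤ Subgroup.zpowers h ⊔ Subgroup.zpowers g := by
    rw [Subgroup.closure_le, Set.pair_subset_iff]
    exact ⟨Subgroup.mem_sup_right (Subgroup.mem_zpowers g),
      Subgroup.mem_sup_left (Subgroup.mem_zpowers h)⟩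
  have hzle : Subgroup.zpowers h ≤ Subgroup.closure {g, h} := Subgroup.zpowers_le.2 hhH
  refine ⟨Subgroup.zpowers ⟨g, hgH⟩, ?_, inferInstance⟩
  have : Finite (Subgroup.closure {g, h} ⧸
      Subgroup.zpowers (⟨g, hgH⟩ : Subgroup.closure {g, h})) := by
    refine Finite.of_surjective (fun b : Subgroup.zpowers h =>
      ((⟨b, hzle b.2⟩ : Subgroup.closure {g, h}) : Subgroup.closure {g, h} ⧸
        Subgroup.zpowers (⟨g, hgH⟩ : Subgroup.closure {g, h}))) fun q => ?_
    obtain ⟨a, rfl⟩ := QuotientGroup.mk_surjective q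
    have ha : (a : G) ∈ (Subgroup.zpowers h : Set G) * (Subgroup.zpowers g : Set G) := by
      rw [← hmul]
      exact hle a.2
    obtain ⟨b, hb, c, ⟨k, rfl⟩, hbc⟩ := Set.mem_mul.1 ha
    refine ⟨⟨b, hb⟩, QuotientGroup.eq.2 ⟨k, Subtype.ext ?_⟩⟩
    simp [← hbc]
  exact Subgroup.finiteIndex_of_finite_quotient

/-- A finite cyclic group has one subgroup of each order. Equal orders give the exponents the same
gcd with `orderOf c`, and Bézout supplies the power. -/
theorem mem_zpowers_of_orderOf_eq {c : G} (hc : IsOfFinOrder c) {a b : G}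
    (ha : a ∈ Subgroup.zpowers c) (hb : b ∈ Subgroup.zpowers c) (hab : orderOf a = orderOf b) :
    b ∈ Subgroup.zpowers a := by
  obtain ⟨p, rfl⟩ := hc.mem_powers_iff_mem_zpowers.2 ha
  obtain ⟨q, rfl⟩ := hc.mem_powers_iff_mem_zpowers.2 hb
  dsimp only at hab ⊢
  rw [hc.orderOf_pow, hc.orderOf_pow] at hab
  have hgcd : (orderOf c).gcd p = (orderOf c).gcd q := by
    rw [← Nat.div_div_self (Nat.gcd_dvd_left (orderOf c) p) hc.orderOf_pos.ne', hab,
      Nat.div_div_self (Nat.gcd_dvd_left (orderOf c) q) hc.orderOf_pos.ne']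
  obtain ⟨k, hk⟩ := (hgcd ▸ Nat.gcd_dvd_right (orderOf c) q : (orderOf c).gcd p ∣ q)
  have hbez := Nat.gcd_eq_gcd_ab (orderOf c) p
  refine ⟨(orderOf c).gcdB p * k, ?_⟩
  dsimp only
  conv_rhs => rw [hk, pow_mul, ← zpow_natCast c, hbez, zpow_add, zpow_mul, zpow_natCast,
    pow_orderOf_eq_one, one_zpow, one_mul, zpow_mul, zpow_natCast, ← zpow_natCast _ k, ← zpow_mul]

end Elementary

/-! ### An element and its conjugate in a common elementary subgroup. -/

section ElementaryConj

variable {G X : Type*} [Group G] [MetricSpace X] [MulAction G X] [IsIsometricSMul G X] {δ : ℝ}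

theorem smul_mem_axis_of_conj {a w : G} (h : a * w * a⁻¹ = w ∨ a * w * a⁻¹ = w⁻¹) {x : X}
    (hx : x ∈ axis X δ w) : a • x ∈ axis X δ w := by
  have := smul_mem_axis_conj (a := a) hx
  rcases h with h | h <;> rw [h] at this
  · exact this
  · rwa [axis_inv] at this

theorem smul_mem_axis_of_mem_closure {S : Set G} {w : G}
    (hS : ∀ a ∈ S, a * w * a⁻¹ = w ∨ a * w * a⁻¹ = w⁻¹) {a : G} (ha : a ∈ Subgroup.closure S)
    {x : X} (hx : x ∈ axis X δ w) : a • x ∈ axis X δ w := by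
  refine smul_mem_axis_of_conj ?_ hx
  induction ha using Subgroup.closure_induction with
  | mem a ha => exact hS a ha
  | one => simp
  | mul a b _ _ iha ihb =>
    have e : a * b * w * (a * b)⁻¹ = a * (b * w * b⁻¹) * a⁻¹ := by group
    rw [e]
    rcases ihb with ihb | ihb <;> rw [ihb]
    · exact iha
    · rw [← conj_inv, inv_inj, inv_eq_iff_eq_inv]
      exact iha.symm
  | inv a _ ih =>
    rcases ih with ih | ih
    · left
      conv_lhs => rw [← ih]
      group
    · right
      have e : w = a * w⁻¹ * a⁻¹ := by rw [← conj_inv, ih, inv_inv]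
      conv_lhs => rw [e]
      group

/-- If every elementary subgroup is cyclic, then `g` and `h` generate an elementary subgroup as
soon as `h` and one of its conjugates by `g` do. -/
theorem isElementary_closure_of_conj [ProperSpace X] [Nonempty X] (hδ : 0 < δ)
    (hgeod : IsGeodesicSpace X) (hhyp : IsDeltaHyperbolic X δ)
    (hproper : IsProperAction G X) (hcocompact : IsCocompactAction G X)
    (hcyclic : ∀ H : Subgroup G, IsElementary H → IsCyclic H) {g h : G}
    (hel : IsElementary (Subgroup.closure {h, g * h * g⁻¹})) :
    IsElementary (Subgroup.closure {g, h}) := by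
  obtain ⟨c, hc⟩ := (hcyclic _ hel).exists_generator
  have hc' : ∀ a ∈ Subgroup.closure {h, g * h * g⁻¹}, a ∈ Subgroup.zpowers (c : G) := by
    intro a ha
    obtain ⟨k, hk⟩ := hc ⟨a, ha⟩
    exact ⟨k, congrArg Subtype.val hk⟩
  have h1 := hc' h (Subgroup.subset_closure (by simp))
  have h2 := hc' (g * h * g⁻¹) (Subgroup.subset_closure (by simp))
  have hord : orderOf h = orderOf (g * h * g⁻¹) :=
    (orderOf_injective (MulAut.conj g).toMonoidHom (MulAut.conj g).injective h).symm
  obtain ⟨p, hp : (c : G) ^ p = h⟩ := id h1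
  obtain ⟨q, hq : (c : G) ^ q = g * h * g⁻¹⟩ := id h2
  by_cases hh : IsOfFinOrder h
  · refine isElementary_of_isOfFinOrder_of_conj_mem hh ?_
    rcases eq_or_ne h 1 with rfl | hne
    · simp
    have hp0 : p ≠ 0 := by
      rintro rfl
      exact hne (by simpa using hp.symm)
    exact mem_zpowers_of_orderOf_eq (by
      rw [← hp] at hh
      exact isOfFinOrder_of_zpow hp0 hh) h1 h2 hord
  · have hp0 : p ≠ 0 := by
      rintro rfl
      exact hh (by simp [← hp])
    have hq0 : q ≠ 0 := by
      rintro rfl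
      rw [zpow_zero] at hq
      exact hh (by rw [← orderOf_pos_iff, hord, ← hq]; simp)
    -- With `h = c ^ p` and `ghg⁻¹ = c ^ q`, both sides are `c ^ (p * q)`.
    have hpq : g * h ^ p * g⁻¹ = h ^ q := by
      rw [← conj_zpow, ← hq]
      conv_rhs => rw [← hp]
      rw [← zpow_mul, ← zpow_mul, mul_comm]
    have hqp : g⁻¹ * h ^ q * g⁻¹⁻¹ = h ^ p := by
      rw [← hpq]; group
    have habs : p.natAbs = q.natAbs := le_antisymm
      (natAbs_le_of_conj_zpow hδ hgeod hhyp hproper hcocompact hh hq0 hp0 hqp)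
      (natAbs_le_of_conj_zpow hδ hgeod hhyp hproper hcocompact hh hp0 hq0 hpq)
    have hhp : ¬ IsOfFinOrder (h ^ p) := fun hf =>
      hh (isOfFinOrder_of_zpow hp0 hf)
    obtain ⟨k, hk⟩ := exists_lt_translationLength_pow hδ hgeod hhyp hproper hcocompact hhp (8 * δ)
    -- Take `w = (h ^ p) ^ k`: it is loxodromic, `h` commutes with it, and `g` sends it to `w` or
    -- `w⁻¹`.
    have hhH : h ∈ Subgroup.closure {g, h} := Subgroup.subset_closure (by simp)
    refine isElementary_of_le_stabilizer_axis hδ hgeod hhyp hproper hcocompact hk.le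
      (pow_mem (zpow_mem hhH p) k) fun a ha x hx => smul_mem_axis_of_mem_closure ?_ ha hx
    rintro a (rfl | rfl)
    · rw [← conj_pow, hpq]
      rcases Int.natAbs_eq_natAbs_iff.1 habs with h3 | h3
      · left; rw [h3]
      · right; rw [h3, zpow_neg, inv_pow, inv_inv]
    · left
      rw [mul_inv_eq_iff_eq_mul]
      exact ((Commute.refl a).zpow_right p).pow_right k

end ElementaryConj

/-! ### Lower bounds for overlaps of axes. -/

section Overlap

variable {G X : Type*} [Group G] [MetricSpace X] [MulAction G X] {δ : ℝ}

theorem closure_pair_inv_left (g h : G) :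
    Subgroup.closure {g⁻¹, h} = Subgroup.closure {g, h} := by
  simp only [Set.insert_eq, Subgroup.closure_union, Subgroup.closure_singleton_inv]

theorem closure_pair_inv_right (g h : G) :
    Subgroup.closure {g, h⁻¹} = Subgroup.closure {g, h} := by
  simp only [Set.insert_eq, Subgroup.closure_union, Subgroup.closure_singleton_inv]

theorem ofReal_dist_le_axesOverlap {g h : G} {x y a b c d : X}
    (ha : a ∈ axis X δ g) (hxa : dist x a ≤ 17 * δ) (hb : b ∈ axis X δ h)
    (hxb : dist x b ≤ 17 * δ) (hc : c ∈ axis X δ g) (hyc : dist y c ≤ 17 * δ)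
    (hd : d ∈ axis X δ h) (hyd : dist y d ≤ 17 * δ) :
    ENNReal.ofReal (dist x y) ≤ axesOverlap X δ g h := by
  rw [← edist_dist]
  exact Metric.edist_le_ediam_of_mem
    ⟨Metric.mem_cthickening_of_dist_le x a _ _ ha hxa,
      Metric.mem_cthickening_of_dist_le x b _ _ hb hxb⟩
    ⟨Metric.mem_cthickening_of_dist_le y c _ _ hc hyc,
      Metric.mem_cthickening_of_dist_le y d _ _ hd hyd⟩

/-- If the middle part of a segment is near two axes, then the axes have a large overlap. -/
theorem ofReal_le_axesOverlap_of_segment (hδ : 0 < δ) (hgeod : IsGeodesicSpace X) {g h : G}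
    {x y : X} {c : ℝ} (hc : 0 ≤ c)
    (hg : ∀ m, dist x m + dist m y = dist x y → c ≤ dist x m → c ≤ dist m y →
      ∃ a ∈ axis X δ g, dist m a ≤ 11 * δ)
    (hh : ∀ m, dist x m + dist m y = dist x y → c ≤ dist x m → c ≤ dist m y →
      ∃ a ∈ axis X δ h, dist m a ≤ 11 * δ) :
    ENNReal.ofReal (dist x y - 2 * c) ≤ axesOverlap X δ g h := by
  rcases le_total (dist x y) (2 * c) with h1 | h1
  · rw [ENNReal.ofReal_of_nonpos (by linarith)]
    exact zero_le
  obtain ⟨p, hp1, hp2⟩ := hgeod.exists_between x y (t := c) hc (by linarith)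
  obtain ⟨q, hq1, hq2⟩ := hgeod.exists_between x y (t := dist x y - c) (by linarith)
    (by linarith)
  obtain ⟨a, ha, hpa⟩ := hg p (by linarith) (by linarith) (by linarith)
  obtain ⟨b, hb, hpb⟩ := hh p (by linarith) (by linarith) (by linarith)
  obtain ⟨a', ha', hqa⟩ := hg q (by linarith) (by linarith) (by linarith)
  obtain ⟨b', hb', hqb⟩ := hh q (by linarith) (by linarith) (by linarith)
  refine le_trans (ENNReal.ofReal_le_ofReal ?_) (ofReal_dist_le_axesOverlap ha (by linarith) hb
    (by linarith) ha' (by linarith) hb' (by linarith) (x := p) (y := q))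
  have := dist_triangle4 x p q y
  linarith

variable [IsIsometricSMul G X]

theorem exists_mem_axis_of_mem_cthickening [ProperSpace X] (hδ : 0 < δ) {g : G} {x : X}
    (hx : x ∈ Metric.cthickening (17 * δ) (axis X δ g)) :
    ∃ a ∈ axis X δ g, dist x a ≤ 17 * δ := by
  rw [(isClosed_axis g).cthickening_eq_biUnion_closedBall (by positivity)] at hx
  simpa using hx

/-- The overlap of the axes of `g` and `h` and that of the axes of `g` and its conjugate by `h`,
where `h` translates `y` towards `x`. -/
theorem ofReal_le_axesOverlap_conj [ProperSpace X] (hδ : 0 < δ) (hgeod : IsGeodesicSpace X)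
    (hhyp : IsDeltaHyperbolic X δ) {g h : G} {x y a b : X} {l : ℝ}
    (hx : dist (h • x) x ≤ l) (hy : dist (h • y) y ≤ l)
    (ha : a ∈ axis X δ g) (hxa : dist x a ≤ 34 * δ)
    (hb : b ∈ axis X δ g) (hyb : dist y b ≤ 34 * δ)
    (hxy : dist x (h • y) ≤ dist x y - l + 6 * δ) :
    ENNReal.ofReal (dist x y - l - 80 * δ) ≤ axesOverlap X δ g (h * g * h⁻¹) := by
  -- On `[x, h y]`, points `40δ` from the ends exceed the `34δ` of the hypotheses by more than the
  -- `2δ` that `exists_mem_axis_of_between_of_near` needs. Both axes follow this segment: `A_g` runs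
  -- near `[x, y]`, and `h A_g` near `[h x, h y]`.
  refine le_trans (ENNReal.ofReal_le_ofReal ?_)
    (ofReal_le_axesOverlap_of_segment hδ hgeod (x := x) (y := h • y) (c := 40 * δ)
      (by positivity) (fun m hm h1 h2 => ?_) (fun m hm h1 h2 => ?_))
  · have := dist_triangle x (h • y) y
    linarith
  · refine exists_mem_axis_of_between_of_near hδ hgeod hhyp ha hb hm ?_ ?_
    · have t1 := dist_triangle x a m
      linarith
    · have t1 := dist_triangle (h • y) y b
      have t2 := dist_triangle y b m
      have t3 := dist_triangle x m y
      have c1 := dist_comm m y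
      have c2 := dist_comm m (h • y)
      linarith
  · refine exists_mem_axis_of_between_of_near hδ hgeod hhyp (smul_mem_axis_conj (a := h) ha)
      (smul_mem_axis_conj (a := h) hb) hm ?_ ?_
    · have e1 : dist (h • x) (h • a) = dist x a := dist_smul h x a
      have e2 : dist (h • x) (h • y) = dist x y := dist_smul h x y
      have t1 := dist_triangle x (h • x) (h • a)
      have t2 := dist_triangle (h • x) (h • a) m
      have t3 := dist_triangle (h • x) m (h • y)
      have c1 := dist_comm x (h • x)
      linarith
    · have e1 : dist (h • y) (h • b) = dist y b := dist_smul h y b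
      have t1 := dist_triangle (h • y) (h • b) m
      have c2 := dist_comm m (h • y)
      linarith

/-! ### The estimate with one short element. -/

theorem axesOverlap_le_of_short [ProperSpace X] [Nonempty X] (hδ : 0 < δ)
    (hgeod : IsGeodesicSpace X) (hhyp : IsDeltaHyperbolic X δ)
    (hproper : IsProperAction G X) (hcocompact : IsCocompactAction G X)
    (hcyclic : ∀ H : Subgroup G, IsElementary H → IsCyclic H) {g h : G}
    (hgh : ¬ IsElementary (Subgroup.closure {g, h})) (hg : translationLength X g ≤ 1000 * δ) :
    axesOverlap X δ g h ≤ ENNReal.ofReal (translationLength X h) + overlapInvariant G X δ +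
      ENNReal.ofReal (158 * δ) := by
  have hle : ∀ k, ¬ IsElementary (Subgroup.closure {g, k}) → translationLength X k ≤ 1000 * δ →
      axesOverlap X δ g k ≤ overlapInvariant G X δ := fun k hk hk' =>
    le_iSup₂ (f := fun (p : G × G) (_ : p ∈ shortPairs G X δ) => axesOverlap X δ p.1 p.2)
      (g, k) ⟨hk, hg, hk'⟩
  rcases le_or_gt (translationLength X h) (1000 * δ) with hh | hh
  · exact (hle h hgh hh).trans (le_add_right le_add_self)
  have hconj : axesOverlap X δ g (h * g * h⁻¹) ≤ overlapInvariant G X δ := by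
    refine hle _ (fun hel => hgh ?_) (by rwa [translationLength_conj])
    rw [Set.pair_comm]
    exact isElementary_closure_of_conj hδ hgeod hhyp hproper hcocompact hcyclic hel
  refine Metric.ediam_le fun x hx y hy => ?_
  obtain ⟨a, ha, hxa⟩ := exists_mem_axis_of_mem_cthickening hδ hx.1
  obtain ⟨b, hb, hyb⟩ := exists_mem_axis_of_mem_cthickening hδ hy.1
  obtain ⟨c, hc, hxc⟩ := exists_mem_axis_of_mem_cthickening hδ hx.2
  obtain ⟨d, hd, hyd⟩ := exists_mem_axis_of_mem_cthickening hδ hy.2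
  set l := translationLength X h with hl
  have hl8 : 8 * δ ≤ l := by linarith
  -- Passing from `x, y` to `c, d` on `A_h` loses `34δ` and the conjugation lemma `80δ`, so `158δ`
  -- leaves room.
  have key : ENNReal.ofReal (dist x y - l - 158 * δ) ≤ overlapInvariant G X δ := by
    rcases le_total (dist x y) (l + 158 * δ) with h1 | h1
    · rw [ENNReal.ofReal_of_nonpos (by linarith)]
      exact zero_le
    have t1 := dist_triangle4 x c d y
    have t2 := dist_triangle c x a
    have t3 := dist_triangle d y b
    rw [dist_comm c x] at t2
    rw [dist_comm d y] at t3
    rw [dist_comm d y] at t1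
    have hc' := dist_smul_le_translationLength hl8 hc
    have hd' := dist_smul_le_translationLength hl8 hd
    refine le_trans ?_ hconj
    rcases hhyp.dist_smul_le_of_mem_axis hgeod hδ hl8 hc hd (by linarith) with h2 | h2
    · refine le_trans (ENNReal.ofReal_le_ofReal ?_) (ofReal_le_axesOverlap_conj hδ hgeod hhyp
        hc' hd' ha (by linarith) hb (by linarith) h2)
      linarith
    · rw [dist_comm c d] at h2
      refine le_trans (ENNReal.ofReal_le_ofReal ?_) (ofReal_le_axesOverlap_conj hδ hgeod hhyp
        hd' hc' hb (by linarith) ha (by linarith) h2)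
      rw [dist_comm d c]
      linarith
  calc edist x y = ENNReal.ofReal (l + (dist x y - l - 158 * δ) + 158 * δ) := by
        rw [edist_dist]; congr 1; ring
    _ ≤ ENNReal.ofReal l + ENNReal.ofReal (dist x y - l - 158 * δ) + ENNReal.ofReal (158 * δ) :=
        ENNReal.ofReal_add_le.trans (by gcongr; exact ENNReal.ofReal_add_le)
    _ ≤ _ := by gcongr

/-! ### Two long elements and their commutator. -/

/-- `h` moves the segment `[x, y]` along itself, towards `y`, by about `l`. -/
structure ShiftsSegment (δ l : ℝ) (h : G) (x y : X) : Prop where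
  left : dist (h • x) x ≤ l + 34 * δ
  right : dist (h • y) y ≤ l + 34 * δ
  towards : dist y (h • x) ≤ dist x y - l + 74 * δ

/-- The translation estimate holds on the axis, `17δ` away from `x` and `y`. Each displacement loses
`2 * 17δ = 34δ`, and the crossed distance goes from `6δ` to `6δ + 4 * 17δ = 74δ`. The direction
decides between `h` and `h⁻¹`. -/
theorem exists_shiftsSegment [ProperSpace X] (hδ : 0 < δ) (hgeod : IsGeodesicSpace X)
    (hhyp : IsDeltaHyperbolic X δ) {h : G} (hh : 8 * δ ≤ translationLength X h) {x y : X}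
    (hx : x ∈ Metric.cthickening (17 * δ) (axis X δ h))
    (hy : y ∈ Metric.cthickening (17 * δ) (axis X δ h))
    (hxy : translationLength X h + 34 * δ ≤ dist x y) :
    ShiftsSegment δ (translationLength X h) h x y ∨
      ShiftsSegment δ (translationLength X h) h⁻¹ x y := by
  obtain ⟨c, hc, hxc⟩ := exists_mem_axis_of_mem_cthickening hδ hx
  obtain ⟨d, hd, hyd⟩ := exists_mem_axis_of_mem_cthickening hδ hy
  have hc' := dist_smul_le_translationLength hh hc
  have hd' := dist_smul_le_translationLength hh hd
  have h1 := dist_smul_self_le h x c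
  have h2 := dist_smul_self_le h y d
  have t1 := dist_triangle4 x c d y
  have t2 := dist_triangle4 c x y d
  rw [dist_comm d y] at t1
  rw [dist_comm c x] at t2
  rcases hhyp.dist_smul_le_of_mem_axis hgeod hδ hh hc hd (by linarith) with h3 | h3
  · right
    refine ⟨?_, ?_, ?_⟩
    · rw [dist_comm, dist_inv_smul_right]; linarith
    · rw [dist_comm, dist_inv_smul_right]; linarith
    · rw [dist_inv_smul_right, dist_comm]
      have t3 := dist_triangle4 x c (h • d) (h • y)
      rw [dist_smul, dist_comm d y] at t3
      linarith
  · left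
    refine ⟨by linarith, by linarith, ?_⟩
    have t3 := dist_triangle4 y d (h • c) (h • x)
    rw [dist_smul, dist_comm c x] at t3
    linarith

/-- The point advances by about `l`. Upper bounds `P`, `Q` in place of exact distances let the
estimate be iterated, and `hPQ` makes the unwanted alternative of the four point inequality give the
same bound. -/
theorem ShiftsSegment.dist_smul_le (hhyp : IsDeltaHyperbolic X δ) {l : ℝ} {h : G} {x y : X}
    (H : ShiftsSegment δ l h x y) {p : X} {P Q : ℝ} (hP : dist x p ≤ P) (hQ : dist p y ≤ Q)
    (hPQ : P + 2 * l ≤ Q + dist x y + 40 * δ) :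
    dist x (h • p) ≤ P + (l + 34 * δ) ∧ dist (h • p) y ≤ Q + (76 * δ - l) := by
  have h1 := H.left
  have h2 := H.right
  have h3 := H.towards
  constructor
  · have := dist_triangle x (h • x) (h • p)
    rw [dist_smul, dist_comm x (h • x)] at this
    linarith
  · have := hhyp.four_point (h • p) (h • x) y (h • y)
    rw [dist_smul, dist_smul, dist_smul, dist_comm p x, dist_comm y (h • y),
      dist_comm (h • x) y, ← sub_le_iff_le_add, le_max_iff] at this
    rcases this with this | this <;> linarith

/-- Both `g h m` and `h g m` lie near the point of `[x, y]` that is `l + k` beyond `m`. Two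
applications of `dist_smul_le` cost `68δ` on the side of `x` and `152δ` on that of `y`; the four
point inequality adds `2δ`. -/
theorem ShiftsSegment.dist_comm_le (hδ : 0 < δ) (hhyp : IsDeltaHyperbolic X δ) {l k : ℝ}
    {g h : G} {x y : X} (Hg : ShiftsSegment δ l g x y) (Hh : ShiftsSegment δ k h x y)
    (hl : 0 ≤ l) (hk : 0 ≤ k)
    {m : X} (hm : dist x m + dist m y = dist x y) (hmy : dist x m + l + k ≤ dist x y) :
    dist (((h * g)⁻¹ * (g * h)) • m) m ≤ 222 * δ := by
  obtain ⟨a1, a2⟩ := Hh.dist_smul_le hhyp (le_refl (dist x m)) (le_refl (dist m y)) (by linarith)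
  obtain ⟨a3, a4⟩ := Hg.dist_smul_le hhyp a1 a2 (by linarith)
  obtain ⟨b1, b2⟩ := Hg.dist_smul_le hhyp (le_refl (dist x m)) (le_refl (dist m y)) (by linarith)
  obtain ⟨b3, b4⟩ := Hh.dist_smul_le hhyp b1 b2 (by linarith)
  have h1 := hhyp.four_point (g • h • m) x (h • g • m) y
  rw [dist_comm (g • h • m) x, ← sub_le_iff_le_add, le_max_iff] at h1
  rw [mul_smul, dist_comm, dist_inv_smul_right, mul_smul, mul_smul, dist_comm]
  rcases h1 with h1 | h1 <;> linarith

/-- If `g` and `h` both move a long segment `[x, y]` along itself, then their commutator has a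
short translation length, and its axis has a large overlap with that of `h`. -/
theorem ShiftsSegment.ofReal_le_axesOverlap [ProperSpace X] [Nonempty X] (hδ : 0 < δ)
    (hgeod : IsGeodesicSpace X) (hhyp : IsDeltaHyperbolic X δ)
    (hproper : IsProperAction G X) (hcocompact : IsCocompactAction G X) {l k : ℝ} {g h : G}
    {x y : X} (Hg : ShiftsSegment δ l g x y) (Hh : ShiftsSegment δ k h x y)
    (hl : 0 ≤ l) (hk : 0 ≤ k) (hxy : l + k ≤ dist x y)
    (hx : x ∈ Metric.cthickening (17 * δ) (axis X δ h))
    (hy : y ∈ Metric.cthickening (17 * δ) (axis X δ h)) :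
    ENNReal.ofReal (dist x y - l - k - 240 * δ) ≤
      axesOverlap X δ ((h * g)⁻¹ * (g * h)) h := by
  -- Up to `n` there is room for `g` and `h` to advance without passing `y`, so the commutator moves
  -- both `x` and `n` by at most `222δ`. They are then within `112δ` of its axis, hence the margin
  -- `120δ` below.
  obtain ⟨n, hn1, hn2⟩ := hgeod.exists_between x y (t := dist x y - l - k)
    (by linarith) (by linarith)
  set u := (h * g)⁻¹ * (g * h) with hu
  have hux : dist (u • x) x ≤ 222 * δ :=
    Hg.dist_comm_le hδ hhyp Hh hl hk (by simp) (by simpa using hxy)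
  have hun : dist (u • n) n ≤ 222 * δ :=
    Hg.dist_comm_le hδ hhyp Hh hl hk (by linarith) (by linarith)
  have hne := axis_nonempty hproper hcocompact δ u
  obtain ⟨a, ha, hxa⟩ := exists_mem_axis_dist_le hδ hgeod hhyp hne x
  obtain ⟨b, hb, hnb⟩ := exists_mem_axis_dist_le hδ hgeod hhyp hne n
  obtain ⟨c, hc, hxc⟩ := exists_mem_axis_of_mem_cthickening hδ hx
  obtain ⟨d, hd, hyd⟩ := exists_mem_axis_of_mem_cthickening hδ hy
  have h8 := le_max_right (translationLength X u) (8 * δ)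
  refine le_trans (ENNReal.ofReal_le_ofReal ?_)
    (ofReal_le_axesOverlap_of_segment hδ hgeod (x := x) (y := n) (c := 120 * δ)
      (by positivity) (fun m hm h1 h2 => ?_) (fun m hm h1 h2 => ?_))
  · linarith
  · refine exists_mem_axis_of_between_of_near hδ hgeod hhyp ha hb hm ?_ ?_
    · have t1 := dist_triangle x a m
      have t2 := dist_triangle x m a
      linarith [dist_comm m a]
    · have t1 := dist_triangle n b m
      linarith [dist_comm m n]
  · have t1 := dist_triangle m n y
    have t2 := dist_triangle x m y
    refine exists_mem_axis_of_between_of_near hδ hgeod hhyp hc hd (x := x) (y := y)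
      (by linarith) ?_ ?_
    · have t1 := dist_triangle x c m
      linarith
    · have t1 := dist_triangle y d m
      linarith [dist_comm m y]

theorem IsElementary.of_isCyclic {H : Subgroup G} (hH : IsCyclic H) : IsElementary H :=
  ⟨⊤, inferInstance, inferInstance⟩

/-- The group generated by the commutator and `h` contains `h` and `g⁻¹hg`, and subgroups of cyclic
groups are cyclic. -/
theorem not_isElementary_closure_commutator [ProperSpace X] [Nonempty X] (hδ : 0 < δ)
    (hgeod : IsGeodesicSpace X) (hhyp : IsDeltaHyperbolic X δ)
    (hproper : IsProperAction G X) (hcocompact : IsCocompactAction G X)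
    (hcyclic : ∀ H : Subgroup G, IsElementary H → IsCyclic H) {g h : G}
    (hgh : ¬ IsElementary (Subgroup.closure {g, h})) :
    ¬ IsElementary (Subgroup.closure {(h * g)⁻¹ * (g * h), h}) := by
  intro hel
  have hle : Subgroup.closure {h, g⁻¹ * h * g⁻¹⁻¹} ≤
      Subgroup.closure {(h * g)⁻¹ * (g * h), h} := by
    rw [Subgroup.closure_le, Set.pair_subset_iff]
    have hh : h ∈ Subgroup.closure {(h * g)⁻¹ * (g * h), h} := Subgroup.subset_closure (by simp)
    have hu : (h * g)⁻¹ * (g * h) ∈ Subgroup.closure {(h * g)⁻¹ * (g * h), h} :=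
      Subgroup.subset_closure (by simp)
    refine ⟨hh, ?_⟩
    have := Subgroup.inv_mem _ (Subgroup.mul_mem _ hu (Subgroup.inv_mem _ hh))
    rwa [show ((h * g)⁻¹ * (g * h) * h⁻¹)⁻¹ = g⁻¹ * h * g⁻¹⁻¹ by group] at this
  have hc := hcyclic _ hel
  have hcyc : IsCyclic (Subgroup.closure {h, g⁻¹ * h * g⁻¹⁻¹}) :=
    isCyclic_of_injective (Subgroup.inclusion hle) (Subgroup.inclusion_injective hle)
  have := isElementary_closure_of_conj hδ hgeod hhyp hproper hcocompact hcyclic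
    (IsElementary.of_isCyclic hcyc)
  rw [closure_pair_inv_left] at this
  exact hgh this

/-- The commutator is short, so part 1 applies to it and `h`. This yields the second `‖h‖`, and `398
= 240 + 158`. -/
theorem ofReal_dist_le_of_shiftsSegment [ProperSpace X] [Nonempty X] (hδ : 0 < δ)
    (hgeod : IsGeodesicSpace X) (hhyp : IsDeltaHyperbolic X δ)
    (hproper : IsProperAction G X) (hcocompact : IsCocompactAction G X)
    (hcyclic : ∀ H : Subgroup G, IsElementary H → IsCyclic H) {g h : G}
    (hgh : ¬ IsElementary (Subgroup.closure {g, h})) {x y : X}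
    (Hg : ShiftsSegment δ (translationLength X g) g x y)
    (Hh : ShiftsSegment δ (translationLength X h) h x y)
    (hxy : translationLength X g + translationLength X h ≤ dist x y)
    (hx : x ∈ Metric.cthickening (17 * δ) (axis X δ h))
    (hy : y ∈ Metric.cthickening (17 * δ) (axis X δ h)) :
    ENNReal.ofReal (dist x y) ≤ ENNReal.ofReal (translationLength X g) +
      ENNReal.ofReal (translationLength X h) + ENNReal.ofReal (translationLength X h) +
      overlapInvariant G X δ + ENNReal.ofReal (398 * δ) := by
  set l := translationLength X g with hl
  set k := translationLength X h with hk
  have hl0 : 0 ≤ l := translationLength_nonneg g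
  have hk0 : 0 ≤ k := translationLength_nonneg h
  have hu : translationLength X ((h * g)⁻¹ * (g * h)) ≤ 1000 * δ :=
    (translationLength_le _ x).trans ((Hg.dist_comm_le hδ hhyp Hh hl0 hk0 (by simp)
      (by simpa using hxy)).trans (by linarith))
  have h1 := (Hg.ofReal_le_axesOverlap hδ hgeod hhyp hproper hcocompact Hh hl0 hk0 hxy hx hy).trans
    (axesOverlap_le_of_short hδ hgeod hhyp hproper hcocompact hcyclic
      (not_isElementary_closure_commutator hδ hgeod hhyp hproper hcocompact hcyclic hgh) hu)
  calc ENNReal.ofReal (dist x y)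
      = ENNReal.ofReal (l + k + (dist x y - l - k - 240 * δ) + 240 * δ) := by congr 1; ring
    _ ≤ ENNReal.ofReal l + ENNReal.ofReal k + ENNReal.ofReal (dist x y - l - k - 240 * δ) +
          ENNReal.ofReal (240 * δ) := by
        refine ENNReal.ofReal_add_le.trans ?_
        gcongr
        refine ENNReal.ofReal_add_le.trans ?_
        gcongr
        exact ENNReal.ofReal_add_le
    _ ≤ ENNReal.ofReal l + ENNReal.ofReal k + (ENNReal.ofReal k + overlapInvariant G X δ +
          ENNReal.ofReal (158 * δ)) + ENNReal.ofReal (240 * δ) := by gcongr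
    _ = _ := by
        rw [show 398 * δ = 158 * δ + 240 * δ by ring,
          ENNReal.ofReal_add (by positivity) (by positivity)]
        ring

end Overlap

end HypAction

/-! ### The main theorem. -/

theorem mainTheorem7 {G X : Type*} [Group G] [MetricSpace X] [ProperSpace X]
    [MulAction G X] [IsIsometricSMul G X] (δ : ℝ) (hδ : 0 < δ)
    (hgeod : HypAction.IsGeodesicSpace X)
    (hhyp : HypAction.IsDeltaHyperbolic X δ)
    (hproper : HypAction.IsProperAction G X)
    (hcocompact : HypAction.IsCocompactAction G X)
    (hcyclic : ∀ H : Subgroup G, HypAction.IsElementary H → IsCyclic H)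
    (g h : G) (hgh : ¬ HypAction.IsElementary (Subgroup.closure {g, h})) :
    (HypAction.translationLength X g ≤ 1000 * δ →
      HypAction.axesOverlap X δ g h ≤
        ENNReal.ofReal (HypAction.translationLength X h)
          + HypAction.overlapInvariant G X δ + ENNReal.ofReal (158 * δ)) ∧
    HypAction.axesOverlap X δ g h ≤
      ENNReal.ofReal (HypAction.translationLength X g)
        + ENNReal.ofReal (HypAction.translationLength X h)
        + ENNReal.ofReal (max (HypAction.translationLength X g)
            (HypAction.translationLength X h))
        + HypAction.overlapInvariant G X δ + ENNReal.ofReal (676 * δ) := by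
  open HypAction in
  rcases isEmpty_or_nonempty X with hX | hX
  · have h0 : axesOverlap X δ g h = 0 := Metric.ediam_subsingleton Set.subsingleton_of_subsingleton
    rw [h0]
    exact ⟨fun _ => zero_le, zero_le⟩
  refine ⟨axesOverlap_le_of_short hδ hgeod hhyp hproper hcocompact hcyclic hgh, ?_⟩
  have hδ' : ENNReal.ofReal (158 * δ) ≤ ENNReal.ofReal (676 * δ) :=
    ENNReal.ofReal_le_ofReal (by linarith)
  rcases le_or_gt (translationLength X g) (1000 * δ) with hg | hg
  · refine (axesOverlap_le_of_short hδ hgeod hhyp hproper hcocompact hcyclic hgh hg).trans ?_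
    gcongr
    exact le_add_right le_add_self
  rcases le_or_gt (translationLength X h) (1000 * δ) with hh | hh
  · have hcomm : axesOverlap X δ g h = axesOverlap X δ h g := by
      rw [axesOverlap, axesOverlap, Set.inter_comm]
    rw [hcomm]
    rw [Set.pair_comm] at hgh
    refine (axesOverlap_le_of_short hδ hgeod hhyp hproper hcocompact hcyclic hgh hh).trans ?_
    gcongr
    exact le_add_right (le_add_right le_rfl)
  refine Metric.ediam_le fun x hx y hy => ?_
  rw [edist_dist]
  set l := translationLength X g with hl
  set k := translationLength X h with hk
  have hl0 : 0 ≤ l := translationLength_nonneg g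
  have hk0 : 0 ≤ k := translationLength_nonneg h
  -- At most this distance, the bound holds without the remaining terms; beyond it, the segment is
  -- long enough for both elements to shift it.
  rcases le_total (dist x y) (l + k + 676 * δ) with hxy | hxy
  · calc ENNReal.ofReal (dist x y) ≤ ENNReal.ofReal (l + k + 676 * δ) :=
          ENNReal.ofReal_le_ofReal hxy
      _ = ENNReal.ofReal l + ENNReal.ofReal k + ENNReal.ofReal (676 * δ) := by
          rw [ENNReal.ofReal_add (by positivity) (by positivity), ENNReal.ofReal_add hl0 hk0]
      _ ≤ _ := by
          exact add_le_add_left (le_add_right (le_add_right le_rfl)) _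
  -- Inverses change neither the axes, nor the translation lengths, nor the generated subgroup, so
  -- both elements may be taken to shift towards `y`.
  obtain ⟨g', hg', Hg'⟩ : ∃ g', (g' = g ∨ g' = g⁻¹) ∧ ShiftsSegment δ l g' x y := by
    rcases exists_shiftsSegment hδ hgeod hhyp (by linarith) hx.1 hy.1 (by linarith) with H | H
    exacts [⟨g, .inl rfl, H⟩, ⟨g⁻¹, .inr rfl, H⟩]
  obtain ⟨h', hh', Hh'⟩ : ∃ h', (h' = h ∨ h' = h⁻¹) ∧ ShiftsSegment δ k h' x y := by
    rcases exists_shiftsSegment hδ hgeod hhyp (by linarith) hx.2 hy.2 (by linarith) with H | H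
    exacts [⟨h, .inl rfl, H⟩, ⟨h⁻¹, .inr rfl, H⟩]
  have hcl : Subgroup.closure {g', h'} = Subgroup.closure {g, h} := by
    rcases hg' with rfl | rfl <;> rcases hh' with rfl | rfl <;>
      simp only [closure_pair_inv_left, closure_pair_inv_right]
  have hlg : translationLength X g' = l := by
    rcases hg' with rfl | rfl
    exacts [rfl, translationLength_inv g]
  have hlh : translationLength X h' = k := by
    rcases hh' with rfl | rfl
    exacts [rfl, translationLength_inv h]
  have hax : axis X δ h' = axis X δ h := by
    rcases hh' with rfl | rfl
    exacts [rfl, axis_inv h]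
  have key := ofReal_dist_le_of_shiftsSegment hδ hgeod hhyp hproper hcocompact hcyclic
    (g := g') (h := h') (x := x) (y := y) (by rwa [hcl]) (by rwa [hlg]) (by rwa [hlh])
    (by rw [hlg, hlh]; linarith) (by rw [hax]; exact hx.2) (by rw [hax]; exact hy.2)
  rw [hlg, hlh] at key
  refine key.trans ?_
  gcongr
  · exact le_max_right _ _
  · norm_num
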